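/- Let $\Gamma$ be a finite simplicial graph (undirected, without loops or multiple edges), let $F$ be a field, and let $$A(\Gamma)=\langle V(\Gamma)\mid vw=wv \text{ whenever } \{v,w\}\in E(\Gamma)\rangle$$ be the right-angled Artin group of $\Gamma$. Let $V=H^1(A(\Gamma),F)$ and $W=H^2(A(\Gamma),F)$ be the group cohomology with trivial coefficients, and let $q\colon V\times V\to W$ be the cup product pairing. Then $\Gamma$ is connected (every two vertices are joined by a path; the empty graph counts as connected) if and only if the triple $(V,W,q)$ is pairing-connected, that is, for every direct sum decomposition $V=V_0\oplus V_1$ with $V_0\neq 0$ and $V_1\neq 0$ there are vectors $v_0\in V_0$ and $v_1\in V_1$ with $q(v_0,v_1)\neq 0$. -/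

import Mathlib

universe u

open groupCohomology

/-- The defining relators of the right-angled Artin group of a simple graph: the commutators of
pairs of adjacent vertices. -/
def raagRels {V : Type u} (Γ : SimpleGraph V) : Set (FreeGroup V) :=
  {r | ∃ v w : V, Γ.Adj v w ∧
    r = FreeGroup.of v * FreeGroup.of w * (FreeGroup.of v)⁻¹ * (FreeGroup.of w)⁻¹}

/-- The right-angled Artin group `A(Γ)`: generated by the vertices of `Γ`, subject to the relations
that adjacent vertices commute. -/
abbrev RAAG {V : Type u} (Γ : SimpleGraph V) : Type u :=
  PresentedGroup (raagRels Γ)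

section CupProduct

variable (k G : Type u) [CommRing k] [Group G]

/-- The cup product of inhomogeneous `1`-cocycles with trivial coefficients in `k`: it is the
`2`-cocycle `(g, h) ↦ a g * b h`. -/
def cupCocycles :
    cocycles₁ (Rep.trivial k G k) →ₗ[k] cocycles₁ (Rep.trivial k G k) →ₗ[k]
      cocycles₂ (Rep.trivial k G k) :=
  LinearMap.mk₂ k
    (fun a b => ⟨fun g => (a g.1 : k) * (b g.2 : k), by
      rw [mem_cocycles₂_iff]
      intro g h j
      have ha : (a (g * h) : k) = a g + a h := cocycles₁_map_mul_of_isTrivial a g h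
      have hb : (b (h * j) : k) = b h + b j := cocycles₁_map_mul_of_isTrivial b h j
      change (a (g * h) : k) * b j + (a g : k) * b h = (a h : k) * b j + (a g : k) * b (h * j)
      rw [ha, hb]
      ring⟩)
    (fun a a' b => cocycles₂_ext fun g h => add_mul (a g : k) (a' g : k) (b h : k))
    (fun c a b => cocycles₂_ext fun g h => mul_assoc c (a g : k) (b h : k))
    (fun a b b' => cocycles₂_ext fun g h => mul_add (a g : k) (b h : k) (b' h : k))
    (fun c a b => cocycles₂_ext fun g h => mul_left_comm (a g : k) c (b h : k))

/-- For trivial coefficients the quotient map from `1`-cocycles to `H¹(G, k)` is a linear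
equivalence (there are no nonzero `1`-coboundaries); this is its inverse. -/
noncomputable def H1EquivCocycles :
    H1 (Rep.trivial k G k) ≃ₗ[k] cocycles₁ (Rep.trivial k G k) :=
  (H1IsoOfIsTrivial (Rep.trivial k G k) ≪≫
    (cocycles₁IsoOfIsTrivial (Rep.trivial k G k)).symm).toLinearEquiv

/-- The cup product pairing `H¹(G, k) × H¹(G, k) → H²(G, k)` in group cohomology with trivial
coefficients `k`. It is induced by the cup product of cocycles, see `cupProduct_H1π`. -/
noncomputable def cupProduct :
    H1 (Rep.trivial k G k) →ₗ[k] H1 (Rep.trivial k G k) →ₗ[k] H2 (Rep.trivial k G k) :=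
  ((cupCocycles k G).compl₁₂ (H1EquivCocycles k G).toLinearMap
    (H1EquivCocycles k G).toLinearMap).compr₂ (H2π (Rep.trivial k G k)).hom

variable {k G}

theorem H1EquivCocycles_H1π (a : cocycles₁ (Rep.trivial k G k)) :
    H1EquivCocycles k G (H1π (Rep.trivial k G k) a) = a := by
  refine cocycles₁_ext fun g => ?_
  exact H1IsoOfIsTrivial_H1π_apply_apply a (Additive.ofMul g)

/-- The cup product of the classes of two cocycles is the class of their cup product. -/
theorem cupProduct_H1π (a b : cocycles₁ (Rep.trivial k G k)) :
    cupProduct k G (H1π (Rep.trivial k G k) a) (H1π (Rep.trivial k G k) b) =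
      H2π (Rep.trivial k G k) (cupCocycles k G a b) := by
  simp only [cupProduct, LinearMap.compr₂_apply, LinearMap.compl₁₂_apply, LinearEquiv.coe_coe]
  erw [H1EquivCocycles_H1π, H1EquivCocycles_H1π]

end CupProduct

/-- A vector space `V` with a vector-space valued bilinear pairing `q : V × V → W` is
pairing-connected if for every decomposition of `V` as a direct sum of two nonzero subspaces
`V₀` and `V₁` there are `v₀ ∈ V₀` and `v₁ ∈ V₁` with `q(v₀, v₁) ≠ 0`. -/
def PairingConnected {F V W : Type*} [Field F] [AddCommGroup V] [Module F V]
    [AddCommGroup W] [Module F W] (q : V →ₗ[F] V →ₗ[F] W) : Prop :=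
  ∀ V₀ V₁ : Submodule F V, IsCompl V₀ V₁ → V₀ ≠ ⊥ → V₁ ≠ ⊥ →
    ∃ v₀ ∈ V₀, ∃ v₁ ∈ V₁, q v₀ v₁ ≠ 0

/-!
The space `H¹(A(Γ), F)` is the space of functions `V → F`: a `1`-cocycle with trivial coefficients
is a homomorphism `A(Γ) → F`, and it is determined by its values on the vertices, which are
arbitrary (`raagH1Equiv`). In these coordinates `a ∪ b = 0` if and only if `a v * b w = a w * b v`
for every edge `v w` (`cupProduct_raag_eq_zero_iff`). Necessity holds because a primitive `f` of
`(g, h) ↦ a g * b h` satisfies `a g * b h = f g + f h - f (g * h)`, whose right side is symmetric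
in `g`, `h` when these commute. For sufficiency, the edge condition says exactly that
`v ↦ (a v, b v, 0)` extends to a homomorphism from `A(Γ)` to the Heisenberg group over `F`, and
minus its last coordinate is a primitive.

What remains is linear algebra. If `Γ` is disconnected, the functions supported on a component and
those vanishing on it form a decomposition violating pairing-connectedness. Conversely, let
`V₀ ⊕ V₁` be a decomposition with `q(V₀, V₁) = 0`. If some `a ∈ V₀` has `a v ≠ 0`, then `V₁`
vanishes at `v` and at its neighbours (`eq_zero_of_adj`); as the two summands cannot both vanish
at a vertex, the property that `V₀` does not vanish at `v` spreads along edges. So if `Γ` is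
connected and has at least two vertices, `V₁` vanishes everywhere; with a single vertex a
decomposition into nonzero subspaces is impossible.
-/

/-! ### The Heisenberg group and the vanishing of cup products -/

/-- The Heisenberg group over a commutative ring: triples `(x, y, z)` with
`(x, y, z) * (x', y', z') = (x + x', y + y', z + z' + x * y')`. -/
@[ext]
structure Heisenberg (R : Type*) where
  x : R
  y : R
  z : R

namespace Heisenberg

variable {R : Type*} [CommRing R]

instance : Mul (Heisenberg R) := ⟨fun p q => ⟨p.x + q.x, p.y + q.y, p.z + q.z + p.x * q.y⟩⟩

instance : One (Heisenberg R) := ⟨⟨0, 0, 0⟩⟩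

instance : Inv (Heisenberg R) := ⟨fun p => ⟨-p.x, -p.y, -p.z + p.x * p.y⟩⟩

@[simp] theorem mul_x (p q : Heisenberg R) : (p * q).x = p.x + q.x := rfl
@[simp] theorem mul_y (p q : Heisenberg R) : (p * q).y = p.y + q.y := rfl
@[simp] theorem mul_z (p q : Heisenberg R) : (p * q).z = p.z + q.z + p.x * q.y := rfl
@[simp] theorem one_x : (1 : Heisenberg R).x = 0 := rfl
@[simp] theorem one_y : (1 : Heisenberg R).y = 0 := rfl
@[simp] theorem one_z : (1 : Heisenberg R).z = 0 := rfl
@[simp] theorem inv_x (p : Heisenberg R) : p⁻¹.x = -p.x := rfl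
@[simp] theorem inv_y (p : Heisenberg R) : p⁻¹.y = -p.y := rfl
@[simp] theorem inv_z (p : Heisenberg R) : p⁻¹.z = -p.z + p.x * p.y := rfl

instance : Group (Heisenberg R) :=
  Group.ofLeftAxioms
    (fun p q r => by ext <;> simp <;> ring)
    (fun p => by ext <;> simp)
    (fun p => by ext <;> simp)

end Heisenberg

theorem H2π_cupCocycles_eq_zero_iff {k G : Type u} [CommRing k] [Group G]
    (a b : cocycles₁ (Rep.trivial k G k)) :
    H2π (Rep.trivial k G k) (cupCocycles k G a b) = 0 ↔
      ∃ f : G → k, ∀ g h : G, (a g : k) * (b h : k) = f h - f (g * h) + f g := by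
  rw [H2π_eq_zero_iff]
  constructor
  · rintro ⟨f, hf⟩
    exact ⟨f, fun g h => (congrFun hf (g, h)).symm⟩
  · rintro ⟨f, hf⟩
    exact ⟨f, funext fun p => (hf p.1 p.2).symm⟩

/-! ### Cohomology of a right-angled Artin group in degrees one and two -/

section RAAG

variable {V : Type u} {Γ : SimpleGraph V}

theorem lift_eq_one_of_mem_raagRels {G : Type*} [Group G] {f : V → G}
    (hf : ∀ v w, Γ.Adj v w → f v * f w = f w * f v) :
    ∀ r ∈ raagRels Γ, FreeGroup.lift f r = 1 := by
  rintro _ ⟨v, w, h, rfl⟩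
  simp [hf v w h]

theorem raag_of_mul_of {v w : V} (h : Γ.Adj v w) :
    (PresentedGroup.of v * PresentedGroup.of w : RAAG Γ) =
      PresentedGroup.of w * PresentedGroup.of v := by
  have := PresentedGroup.one_of_mem (rels := raagRels Γ) ⟨v, w, h, rfl⟩
  simp only [map_mul, map_inv] at this
  exact mul_inv_eq_iff_eq_mul.mp (mul_inv_eq_one.mp this)

variable (Γ) (F : Type u) [Field F]

/-- Restriction of a cocycle `A(Γ) → F` to the vertices. -/
def raagCocyclesEval : cocycles₁ (Rep.trivial F (RAAG Γ) F) →ₗ[F] (V → F) where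
  toFun a v := a (PresentedGroup.of v)
  map_add' _ _ := rfl
  map_smul' _ _ := rfl

theorem raagCocyclesEval_bijective : Function.Bijective (raagCocyclesEval Γ F) := by
  constructor
  · intro a b hab
    have h : ((cocycles₁IsoOfIsTrivial (Rep.trivial F (RAAG Γ) F)).hom a).toMultiplicativeRight =
        ((cocycles₁IsoOfIsTrivial (Rep.trivial F (RAAG Γ) F)).hom b).toMultiplicativeRight :=
      PresentedGroup.ext fun v => congrFun hab v
    exact cocycles₁_ext fun g => DFunLike.congr_fun h g
  · intro c
    let φ : RAAG Γ →* Multiplicative F :=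
      PresentedGroup.toGroup (f := fun v => Multiplicative.ofAdd (c v))
        (lift_eq_one_of_mem_raagRels fun v w _ => mul_comm _ _)
    refine ⟨⟨_, mem_cocycles₁_of_addMonoidHom (A := Rep.trivial F (RAAG Γ) F)
      (MonoidHom.toAdditiveLeft φ)⟩, funext fun v => ?_⟩
    have hφ : φ (PresentedGroup.of v) = Multiplicative.ofAdd (c v) := PresentedGroup.toGroup.of _
    exact hφ

/-- The coordinates on `H¹(A(Γ), F)`: a class is given by its values on the vertices. -/
noncomputable def raagH1Equiv : H1 (Rep.trivial F (RAAG Γ) F) ≃ₗ[F] (V → F) :=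
  H1EquivCocycles F (RAAG Γ) ≪≫ₗ
    LinearEquiv.ofBijective (raagCocyclesEval Γ F) (raagCocyclesEval_bijective Γ F)

theorem cupProduct_raag_eq_zero_iff (x y : H1 (Rep.trivial F (RAAG Γ) F)) :
    cupProduct F (RAAG Γ) x y = 0 ↔
      ∀ v w, Γ.Adj v w → raagH1Equiv Γ F x v * raagH1Equiv Γ F y w =
        raagH1Equiv Γ F x w * raagH1Equiv Γ F y v := by
  let a := H1EquivCocycles F (RAAG Γ) x
  let b := H1EquivCocycles F (RAAG Γ) y
  change H2π (Rep.trivial F (RAAG Γ) F) (cupCocycles F (RAAG Γ) a b) = 0 ↔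
    ∀ v w, Γ.Adj v w → (a (PresentedGroup.of v) : F) * (b (PresentedGroup.of w) : F) =
      (a (PresentedGroup.of w) : F) * (b (PresentedGroup.of v) : F)
  rw [H2π_cupCocycles_eq_zero_iff]
  constructor
  · rintro ⟨f, hf⟩ v w h
    rw [hf, hf, raag_of_mul_of h]
    ring
  · intro H
    let φ : RAAG Γ →* Heisenberg F :=
      PresentedGroup.toGroup
        (f := fun v => ⟨a (PresentedGroup.of v), b (PresentedGroup.of v), 0⟩)
        (lift_eq_one_of_mem_raagRels fun v w h => by
          ext
          · exact add_comm _ _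
          · exact add_comm _ _
          · simpa [mul_comm] using H v w h)
    have hφ (v : V) : φ (PresentedGroup.of v) =
        ⟨a (PresentedGroup.of v), b (PresentedGroup.of v), 0⟩ :=
      PresentedGroup.toGroup.of _
    -- The first two coordinates of `φ` are homomorphisms agreeing with `a` and `b` on generators.
    have ha (g : RAAG Γ) : (φ g).x = a g := by
      let α : RAAG Γ →* Multiplicative F :=
        { toFun g := Multiplicative.ofAdd (φ g).x
          map_one' := by simp
          map_mul' := by simp }
      have h : α = ((cocycles₁IsoOfIsTrivial
          (Rep.trivial F (RAAG Γ) F)).hom a).toMultiplicativeRight :=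
        PresentedGroup.ext fun v => congrArg Heisenberg.x (hφ v)
      exact DFunLike.congr_fun h g
    have hb (g : RAAG Γ) : (φ g).y = b g := by
      let β : RAAG Γ →* Multiplicative F :=
        { toFun g := Multiplicative.ofAdd (φ g).y
          map_one' := by simp
          map_mul' := by simp }
      have h : β = ((cocycles₁IsoOfIsTrivial
          (Rep.trivial F (RAAG Γ) F)).hom b).toMultiplicativeRight :=
        PresentedGroup.ext fun v => congrArg Heisenberg.y (hφ v)
      exact DFunLike.congr_fun h g
    refine ⟨fun g => -(φ g).z, fun g h => ?_⟩
    change (a g : F) * (b h : F) = -(φ h).z - -(φ (g * h)).z + -(φ g).z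
    rw [map_mul, Heisenberg.mul_z, ha, hb]
    ring

end RAAG

/-! ### Decompositions of the space of functions on the vertices -/

section Decomposition

variable {V F M N : Type*} [Field F] [AddCommGroup M] [Module F M] [AddCommGroup N] [Module F N]
  {Γ : SimpleGraph V} {q : M →ₗ[F] M →ₗ[F] N} {e : M ≃ₗ[F] (V → F)}

/-- If all of `V₀` and `V₁` pair to zero, in coordinates, and `V₀` does not vanish at `v`, then `V₁`
vanishes at `v` and at its neighbours: otherwise the pairs `(x v, x w)`, for `x` in `V₀` or in
`V₁`, would all lie on one line of `F × F`, although they span `F × F`. -/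
theorem eq_zero_of_adj {V₀ V₁ : Submodule F M} (hc : IsCompl V₀ V₁)
    (h : ∀ x ∈ V₀, ∀ y ∈ V₁, ∀ v w, Γ.Adj v w → e x v * e y w = e x w * e y v)
    {v w : V} (hvw : Γ.Adj v w) {a : M} (ha : a ∈ V₀) (hav : e a v ≠ 0)
    {b : M} (hb : b ∈ V₁) : e b v = 0 ∧ e b w = 0 := by
  classical
  have hbv : e b v = 0 := by
    by_contra hbv
    have h₁ (y : M) (hy : y ∈ V₁) : e y w * e a v = e y v * e a w := by
      linear_combination h a ha y hy v w hvw
    have h₀ (x : M) (hx : x ∈ V₀) : e x w * e a v = e x v * e a w := by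
      apply mul_right_cancel₀ hbv
      linear_combination (-e a v) * h x hx b hb v w hvw + e x v * h a ha b hb v w hvw
    obtain ⟨x, hx, y, hy, hxy⟩ := Submodule.mem_sup.mp
      (hc.sup_eq_top ▸ Submodule.mem_top : e.symm (Pi.single w 1) ∈ V₀ ⊔ V₁)
    have hs := congrArg e hxy
    rw [map_add, e.apply_symm_apply] at hs
    have hsv : e x v + e y v = 0 := by
      simpa [Pi.single_apply, hvw.ne] using congrFun hs v
    have hsw : e x w + e y w = 1 := by simpa using congrFun hs w
    apply hav
    linear_combination h₀ x hx + h₁ y hy - e a v * hsw + e a w * hsv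
  refine ⟨hbv, ?_⟩
  have := h a ha b hb v w hvw
  rw [hbv, mul_zero] at this
  exact (mul_eq_zero.mp this).resolve_left hav

theorem exists_apply_ne_zero {x : M} (hx : x ≠ 0) : ∃ v, e x v ≠ 0 :=
  Function.ne_iff.mp ((map_ne_zero_iff e e.injective).mpr hx)

theorem pairingConnected_of_preconnected
    (hq : ∀ x y, q x y = 0 ↔ ∀ v w, Γ.Adj v w → e x v * e y w = e x w * e y v)
    (hΓ : Γ.Preconnected) : PairingConnected q := by
  classical
  intro V₀ V₁ hc h₀ h₁
  by_contra! H
  replace H : ∀ x ∈ V₀, ∀ y ∈ V₁, ∀ v w, Γ.Adj v w → e x v * e y w = e x w * e y v :=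
    fun x hx y hy => (hq x y).mp (H x hx y hy)
  obtain ⟨a, ha, ha0⟩ := V₀.ne_bot_iff.mp h₀
  obtain ⟨b, hb, hb0⟩ := V₁.ne_bot_iff.mp h₁
  obtain ⟨v, hv⟩ := exists_apply_ne_zero (e := e) ha0
  obtain ⟨w, hw⟩ := exists_apply_ne_zero (e := e) hb0
  rcases subsingleton_or_nontrivial V with hV | hV
  · -- On a single vertex, the nonzero functions `e a` and `e b` are proportional.
    obtain rfl := Subsingleton.elim v w
    have hab : e b v • a = e a v • b := e.injective <| funext fun u => by
      obtain rfl := Subsingleton.elim v u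
      simp [mul_comm]
    have := Submodule.disjoint_def.mp hc.disjoint (e b v • a) (V₀.smul_mem _ ha)
      (hab ▸ V₁.smul_mem _ hb)
    exact (smul_ne_zero hw ha0) this
  · -- The vertices at which `V₀` does not vanish are closed under adjacency.
    have step (u u' : V) (huu' : Γ.Adj u u') (hu : ∃ x ∈ V₀, e x u ≠ 0) :
        ∃ x ∈ V₀, e x u' ≠ 0 := by
      obtain ⟨x, hx, hxu⟩ := hu
      obtain ⟨x', hx', y, hy, hxy⟩ := Submodule.mem_sup.mp
        (hc.sup_eq_top ▸ Submodule.mem_top : e.symm (Pi.single u' 1) ∈ V₀ ⊔ V₁)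
      refine ⟨x', hx', ?_⟩
      have hs := congrFun (congrArg e hxy) u'
      rw [map_add, e.apply_symm_apply, Pi.add_apply,
        (eq_zero_of_adj hc H huu' hx hxu hy).2, add_zero, Pi.single_eq_same] at hs
      simp [hs]
    have hreach (u : V) : ∃ x ∈ V₀, e x u ≠ 0 := by
      have := (Γ.reachable_iff_reflTransGen v u).mp (hΓ v u)
      induction this with
      | refl => exact ⟨a, ha, hv⟩
      | tail _ h ih => exact step _ _ h ih
    obtain ⟨x, hx, hxw⟩ := hreach w
    obtain ⟨u, hu⟩ := hΓ.exists_adj_of_nontrivial w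
    exact hw (eq_zero_of_adj hc H hu hx hxw hb).1

theorem preconnected_of_pairingConnected
    (hq : ∀ x y, q x y = 0 ↔ ∀ v w, Γ.Adj v w → e x v * e y w = e x w * e y v)
    (h : PairingConnected q) : Γ.Preconnected := by
  classical
  by_contra hΓ
  obtain ⟨s, t, hst⟩ : ∃ s t, ¬ Γ.Reachable s t := by
    simpa only [SimpleGraph.Preconnected, not_forall] using hΓ
  let V₀ : Submodule F M :=
    { carrier := {x | ∀ v, ¬ Γ.Reachable s v → e x v = 0}
      zero_mem' := by simp
      add_mem' := fun {x y} hx hy v hv => by simp [hx v hv, hy v hv]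
      smul_mem' := fun c x hx v hv => by simp [hx v hv] }
  let V₁ : Submodule F M :=
    { carrier := {x | ∀ v, Γ.Reachable s v → e x v = 0}
      zero_mem' := by simp
      add_mem' := fun {x y} hx hy v hv => by simp [hx v hv, hy v hv]
      smul_mem' := fun c x hx v hv => by simp [hx v hv] }
  have hc : IsCompl V₀ V₁ := by
    refine ⟨Submodule.disjoint_def.mpr fun x h₀ h₁ => ?_, codisjoint_iff.mpr ?_⟩
    · refine (map_eq_zero_iff e e.injective).mp (funext fun v => ?_)
      by_cases hv : Γ.Reachable s v
      · exact h₁ v hv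
      · exact h₀ v hv
    · refine eq_top_iff.mpr fun x _ => Submodule.mem_sup.mpr ?_
      refine ⟨e.symm fun v => if Γ.Reachable s v then e x v else 0, fun v hv => by simp [hv],
        e.symm fun v => if Γ.Reachable s v then 0 else e x v, fun v hv => by simp [hv], ?_⟩
      apply e.injective
      funext v
      by_cases hv : Γ.Reachable s v <;> simp [hv]
  have hne (u : V) : e.symm (Pi.single u 1) ≠ 0 := by simp
  have h₀ : V₀ ≠ ⊥ := V₀.ne_bot_iff.mpr ⟨e.symm (Pi.single s 1), fun v hv => by
    have : v ≠ s := by rintro rfl; exact hv .rfl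
    simp [this], hne s⟩
  have h₁ : V₁ ≠ ⊥ := V₁.ne_bot_iff.mpr ⟨e.symm (Pi.single t 1), fun v hv => by
    have : v ≠ t := by rintro rfl; exact hst hv
    simp [this], hne t⟩
  obtain ⟨x, hx, y, hy, hxy⟩ := h V₀ V₁ hc h₀ h₁
  refine hxy ((hq x y).mpr fun v w hvw => ?_)
  by_cases hv : Γ.Reachable s v
  · simp [hy v hv, hy w (hv.trans hvw.reachable)]
  · simp [hx v hv, hx w fun hw => hv (hw.trans hvw.symm.reachable)]

end Decomposition

theorem proposition2 {V : Type u} [Finite V] (Γ : SimpleGraph V) (F : Type u) [Field F] :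
    Γ.Preconnected ↔ PairingConnected (cupProduct F (RAAG Γ)) :=
  ⟨pairingConnected_of_preconnected (cupProduct_raag_eq_zero_iff Γ F),
    preconnected_of_pairingConnected (cupProduct_raag_eq_zero_iff Γ F)⟩
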